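/- Let $S\in\{0,\tfrac12,1,\tfrac32,\dots\}$ and $n=2S+1$. For $q>0$ put $[t]_q=\frac{q^t-q^{-t}}{q-q^{-1}}$ if $q\neq1$ and $[t]_1=t$. Let $\mathcal H_S^q=\mathbb C^{n}$, with orthonormal basis $|k\rangle$, $k=S,S-1,\dots,-S$ (the canonical basis of $\mathbb C^n$, $e_a=|S+1-a\rangle$), be the spin $S$ module of $U_q(su_2)$ (of $U(su_2)$ if $q=1$): $$X^+|k\rangle=\sqrt{[S-k]_q\,[S+k+1]_q}\;|k+1\rangle,\quad X^-=(X^+)^*,\quad K^{\pm1}|k\rangle=q^{\pm k}|k\rangle,\quad H|k\rangle=k|k\rangle .$$ On $\mathcal H_S^q\otimes\mathcal H_S^q$ put $\Delta(X^\pm)=X^\pm\otimes K+K^{-1}\otimes X^\pm$, $\Delta(K^{\pm1})=K^{\pm1}\otimes K^{\pm1}$, $\Delta(H)=H\otimes1+1\otimes H$, and let $$\Delta(C_q)=\Delta(X^-)\Delta(X^+)+\frac{(\Delta(K)-\Delta(K^{-1}))(q\Delta(K)-q^{-1}\Delta(K^{-1}))}{(q-q^{-1})^2}\ \ (q\ne1),\qquad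 \Delta(C_1)=\Delta(X^-)\Delta(X^+)+\Delta(H)(\Delta(H)+1).$$ For integers $0\le J\le 2S$ and $|m|\le J$ let $|J,m\rangle_q\in\mathcal H_S^q\otimes\mathcal H_S^q$ be a joint eigenvector, i.e. a nonzero vector with $\Delta(C_q)|J,m\rangle_q=[J]_q[J+1]_q|J,m\rangle_q$ and $\Delta(K)|J,m\rangle_q=q^m|J,m\rangle_q$ (if $q=1$: $\Delta(H)|J,m\rangle_1=m|J,m\rangle_1$). Call $|J,m\rangle_q$ a TL vector (respectively, call two orthogonal vectors $|J_1,m_1\rangle_q,|J_2,m_2\rangle_q$ a TL pair) if there is $Q>0$ such that $T=QP_q$, where $P_q$ is the orthogonal projection onto the span of this vector (respectively, of these two vectors), satisfies $$T^*=T,\qquad T^2=QT,\qquad T_{12}T_{23}T_{12}=T_{12},\qquad T_{23}T_{12}T_{23}=T_{23},$$ with $T_{12}=T\otimes I_n$ and $T_{23}=I_n\otimes T$. Then, for fixed $S$, $J$, $m$ (respectively, fixed $S$, $J_1$, $m_1$, $J_2$, $m_2$ such that the two vectors are orthogonal), $|J,m\rangle_q$ is a TL vector (respectively, $|J_1,m_1\rangle_q,|J_2,m_2\rangle_q$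 is a TL pair) either for all $q>0$ or only for a finite (possibly empty) set of values of $q>0$. -/

import Mathlib

open scoped Kronecker

noncomputable section

namespace TLUq

/-- The first two of three tensor factors: `T₁₂ = T ⊗ I`. -/
def T12 {n : ℕ} (T : Matrix (Fin n × Fin n) (Fin n × Fin n) ℂ) :
    Matrix ((Fin n × Fin n) × Fin n) ((Fin n × Fin n) × Fin n) ℂ :=
  T ⊗ₖ (1 : Matrix (Fin n) (Fin n) ℂ)

/-- The last two of three tensor factors: `T₂₃ = I ⊗ T`, with the index set
`Fin n × (Fin n × Fin n)` rebracketed so that it can be multiplied with `T12 T`. -/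
def T23 {n : ℕ} (T : Matrix (Fin n × Fin n) (Fin n × Fin n) ℂ) :
    Matrix ((Fin n × Fin n) × Fin n) ((Fin n × Fin n) × Fin n) ℂ :=
  Matrix.reindex (Equiv.prodAssoc (Fin n) (Fin n) (Fin n)).symm
    (Equiv.prodAssoc (Fin n) (Fin n) (Fin n)).symm
    ((1 : Matrix (Fin n) (Fin n) ℂ) ⊗ₖ T)

/-- The relations (T1)--(T4) with parameter `Q` for a matrix `T` acting on `ℂⁿ ⊗ ℂⁿ`. -/
structure IsTLSolution {n : ℕ} (Q : ℝ) (T : Matrix (Fin n × Fin n) (Fin n × Fin n) ℂ) :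
    Prop where
  t1 : T.conjTranspose = T
  t2 : T * T = (Q : ℂ) • T
  t3 : T12 T * T23 T * T12 T = T12 T
  t4 : T23 T * T12 T * T23 T = T23 T

/-- The matrix, in the canonical basis, of the orthogonal projection onto a subspace of
`ℂⁿ ⊗ ℂⁿ`. -/
def projMatrix {n : ℕ} (U : Submodule ℂ (EuclideanSpace ℂ (Fin n × Fin n))) :
    Matrix (Fin n × Fin n) (Fin n × Fin n) ℂ :=
  (Matrix.toEuclideanCLM (n := Fin n × Fin n) (𝕜 := ℂ)).symm U.starProjection

/-- `T = Q P`, with `P` the projection onto the line spanned by `v`, solves (T1)--(T4) for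
some `Q > 0`. -/
def IsTLVector {n : ℕ} (v : EuclideanSpace ℂ (Fin n × Fin n)) : Prop :=
  ∃ Q : ℝ, 0 < Q ∧ IsTLSolution Q ((Q : ℂ) • projMatrix (Submodule.span ℂ {v}))

/-- `T = Q P`, with `P` the projection onto the span of the two vectors `v`, `w`, solves
(T1)--(T4) for some `Q > 0`. -/
def IsTLPair {n : ℕ} (v w : EuclideanSpace ℂ (Fin n × Fin n)) : Prop :=
  ∃ Q : ℝ, 0 < Q ∧ IsTLSolution Q ((Q : ℂ) • projMatrix (Submodule.span ℂ {v, w}))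

/-- The `q`-number `[t]_q`. -/
def qNum (q t : ℝ) : ℝ :=
  if q = 1 then t else (q ^ t - q ^ (-t)) / (q - q⁻¹)

/-- Throughout, `N = 2S`, and the basis vector `e_a` of `ℂ^(N+1)`, `a = 0, …, N`, is `|S - a⟩`:
this is its weight. -/
def weight (N : ℕ) (a : Fin (N + 1)) : ℝ := (N : ℝ) / 2 - (a : ℕ)

/-- The generator `H` in the spin `S` module of `U(su₂)`: `H |k⟩ = k |k⟩`. -/
def spinH (N : ℕ) : Matrix (Fin (N + 1)) (Fin (N + 1)) ℂ :=
  Matrix.diagonal fun a => ((weight N a : ℝ) : ℂ)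

/-- The generator `K` in the spin `S` module of `U_q(su₂)`: `K |k⟩ = q^k |k⟩`. -/
def spinK (N : ℕ) (q : ℝ) : Matrix (Fin (N + 1)) (Fin (N + 1)) ℂ :=
  Matrix.diagonal fun a => ((q ^ weight N a : ℝ) : ℂ)

/-- The generator `K⁻¹` in the spin `S` module of `U_q(su₂)`. -/
def spinKinv (N : ℕ) (q : ℝ) : Matrix (Fin (N + 1)) (Fin (N + 1)) ℂ :=
  Matrix.diagonal fun a => ((q ^ (-weight N a) : ℝ) : ℂ)

/-- The generator `X⁺` in the spin `S` module of `U_q(su₂)` (of `U(su₂)` if `q = 1`):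
`X⁺ |k⟩ = ([S - k] [S + k + 1])^(1/2) |k + 1⟩`. -/
def spinXp (N : ℕ) (q : ℝ) : Matrix (Fin (N + 1)) (Fin (N + 1)) ℂ :=
  Matrix.of fun a b =>
    if (b : ℕ) = (a : ℕ) + 1 then
      ((Real.sqrt (qNum q ((N : ℝ) / 2 - weight N b) *
        qNum q ((N : ℝ) / 2 + weight N b + 1)) : ℝ) : ℂ)
    else 0

/-- The generator `X⁻ = (X⁺)^*`. -/
def spinXm (N : ℕ) (q : ℝ) : Matrix (Fin (N + 1)) (Fin (N + 1)) ℂ :=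
  (spinXp N q).conjTranspose

/-- Operators on the tensor square of the spin `S` module. -/
abbrev Op2 (N : ℕ) : Type :=
  Matrix (Fin (N + 1) × Fin (N + 1)) (Fin (N + 1) × Fin (N + 1)) ℂ

/-- `Δ(H) = H ⊗ 1 + 1 ⊗ H`. -/
def deltaH (N : ℕ) : Op2 N :=
  spinH N ⊗ₖ (1 : Matrix (Fin (N + 1)) (Fin (N + 1)) ℂ) +
    (1 : Matrix (Fin (N + 1)) (Fin (N + 1)) ℂ) ⊗ₖ spinH N

/-- `Δ(K) = K ⊗ K`. -/
def deltaK (N : ℕ) (q : ℝ) : Op2 N := spinK N q ⊗ₖ spinK N q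

/-- `Δ(K⁻¹) = K⁻¹ ⊗ K⁻¹`. -/
def deltaKinv (N : ℕ) (q : ℝ) : Op2 N := spinKinv N q ⊗ₖ spinKinv N q

/-- `Δ(X⁺) = X⁺ ⊗ K + K⁻¹ ⊗ X⁺`; at `q = 1`, where `K = 1`, this is `X⁺ ⊗ 1 + 1 ⊗ X⁺`. -/
def deltaXp (N : ℕ) (q : ℝ) : Op2 N :=
  spinXp N q ⊗ₖ spinK N q + spinKinv N q ⊗ₖ spinXp N q

/-- `Δ(X⁻) = X⁻ ⊗ K + K⁻¹ ⊗ X⁻`; at `q = 1`, where `K = 1`, this is `X⁻ ⊗ 1 + 1 ⊗ X⁻`. -/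
def deltaXm (N : ℕ) (q : ℝ) : Op2 N :=
  spinXm N q ⊗ₖ spinK N q + spinKinv N q ⊗ₖ spinXm N q

/-- `Δ(C)` for the Casimir element: for `q = 1`, `C₁ = X⁻ X⁺ + H (H + 1)`; for `q ≠ 1`,
`C_q = X⁻ X⁺ + (K - K⁻¹) (q K - q⁻¹ K⁻¹) / (q - q⁻¹)²`. -/
def deltaC (N : ℕ) (q : ℝ) : Op2 N :=
  if q = 1 then
    deltaXm N q * deltaXp N q + deltaH N * (deltaH N + 1)
  else
    deltaXm N q * deltaXp N q +
      (((q - q⁻¹) ^ 2 : ℝ) : ℂ)⁻¹ •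
        ((deltaK N q - deltaKinv N q) *
          ((q : ℂ) • deltaK N q - (q : ℂ)⁻¹ • deltaKinv N q))

/-- `v` is a joint eigenvector `|J, m⟩_q`: a nonzero vector of the tensor square of the spin
`S = N/2` module with `Δ(K) v = q^m v` (`Δ(H) v = m v` if `q = 1`) and
`Δ(C) v = [J]_q [J+1]_q v`. -/
structure IsJointEigenvector (N : ℕ) (q : ℝ) (J : ℕ) (m : ℤ)
    (v : EuclideanSpace ℂ (Fin (N + 1) × Fin (N + 1))) : Prop where
  ne_zero : v ≠ 0
  weight_eq :
    if q = 1 then (deltaH N).toEuclideanLin v = (m : ℂ) • v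
    else (deltaK N q).toEuclideanLin v = ((q ^ m : ℝ) : ℂ) • v
  casimir_eq :
    (deltaC N q).toEuclideanLin v = ((qNum q J * qNum q (J + 1) : ℝ) : ℂ) • v

end TLUq

end

/-! ### Functions of `s` that are algebraic over polynomials in `exp s`. -/

open scoped Kronecker

noncomputable section

namespace TLUq

/-! Put `q = exp (2 * s)`. Half-integral powers of `q` become integral powers of `exp s`, and every
quantity in the problem becomes a real analytic function of `s` that is algebraic over the
polynomials in `exp s`. Such a function, if not identically zero, divides some nonzero `p (exp s)`,
so it has finitely many zeros. It remains to express the TL property by the vanishing of functions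
of this kind.

The vectors are algebraic because on a weight space `Δ(X⁻)Δ(X⁺)` is tridiagonal with nonvanishing
off-diagonal entries. The eigenvalue equation is then a recursion giving every coordinate as an
algebraic multiple of an extreme one (`exists_isAlg_coordinates`). The unknown scalar, an arbitrary
function of `q`, cancels in the projection; for an orthogonal pair the two projections add up.

The parameter `Q` is eliminated by traces: when `P₁₂ P₂₃ ≠ 0`, a suitable `Q` exists if and only if
`P₁₂ P₂₃ P₁₂` and `P₂₃ P₁₂ P₂₃` are proportional to `P₁₂` and `P₂₃` (`exists_isTLSolution_iff`). The
nonvanishing of `P₁₂ P₂₃` holds for all `q > 0` because both extreme coordinates of the eigenvector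
are nonzero. -/

/-- The ring of real analytic functions on the real line. -/
def analyticFunctions : Subalgebra ℝ (ℝ → ℝ) where
  carrier := {f | AnalyticOnNhd ℝ f Set.univ}
  mul_mem' hf hg := AnalyticOnNhd.mul hf hg
  add_mem' hf hg := AnalyticOnNhd.add hf hg
  algebraMap_mem' _ := analyticOnNhd_const

/-- The identity theorem on the connected real line. It makes nonzero functions cancellable, as
arguments about algebraic elements require. -/
instance : NoZeroDivisors analyticFunctions where
  eq_zero_or_eq_zero_of_mul_eq_zero {f g} h := by
    have hfg : ∀ x ∈ Set.univ, (f : ℝ → ℝ) x * (g : ℝ → ℝ) x = 0 := fun x _ =>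
      congrFun (congrArg Subtype.val h) x
    rcases AnalyticOnNhd.eq_zero_or_eq_zero_of_mul_eq_zero f.2 g.2 hfg
      isPreconnected_univ with h | h
    · exact Or.inl (Subtype.ext (funext fun x => h x trivial))
    · exact Or.inr (Subtype.ext (funext fun x => h x trivial))

/-- The exponential function, as an analytic function. -/
def expFunction : analyticFunctions := ⟨Real.exp, fun _ _ => analyticAt_rexp⟩

/-- Analytic functions form an algebra over the polynomials in the exponential function. -/
instance : Algebra (Polynomial ℝ) analyticFunctions :=
  (Polynomial.aeval expFunction).toRingHom.toAlgebra

theorem algebraMap_analyticFunctions_apply (p : Polynomial ℝ) (s : ℝ) :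
    (algebraMap (Polynomial ℝ) analyticFunctions p : ℝ → ℝ) s = p.eval (Real.exp s) := by
  let ev : analyticFunctions →ₐ[ℝ] ℝ := (Pi.evalAlgHom ℝ (fun _ : ℝ => ℝ) s).comp
    analyticFunctions.val
  have h : ev (Polynomial.aeval expFunction p) = Polynomial.aeval (ev expFunction) p :=
    (Polynomial.aeval_algHom_apply ev expFunction p).symm
  rw [Polynomial.aeval_def, Polynomial.eval₂_eq_eval_map] at h
  simp only [Polynomial.eval_map_algebraMap, Polynomial.coe_aeval_eq_eval] at h
  exact h

/-- A complex valued function on the real line is *algebraic* here if its values are real, it is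
analytic, and it is algebraic over the polynomials in the exponential function. -/
def IsAlg (f : ℝ → ℂ) : Prop :=
  ∃ F : analyticFunctions, IsAlgebraic (Polynomial ℝ) F ∧ ∀ s, f s = ((F : ℝ → ℝ) s : ℂ)

namespace IsAlg

variable {f g : ℝ → ℂ}

theorem congr (hf : IsAlg f) (h : ∀ s, g s = f s) : IsAlg g := by
  rwa [funext h]

theorem const (r : ℝ) : IsAlg fun _ => (r : ℂ) := by
  refine ⟨algebraMap _ _ (Polynomial.C r), isAlgebraic_algebraMap _, fun s => ?_⟩
  rw [algebraMap_analyticFunctions_apply, Polynomial.eval_C]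

theorem zero : IsAlg fun _ => 0 := by simpa using const 0

theorem one : IsAlg fun _ => 1 := by simpa using const 1

theorem add (hf : IsAlg f) (hg : IsAlg g) : IsAlg fun s => f s + g s := by
  obtain ⟨F, hF, hF'⟩ := hf
  obtain ⟨G, hG, hG'⟩ := hg
  exact ⟨F + G, hF.add hG, fun s => by simp [hF', hG']⟩

theorem mul (hf : IsAlg f) (hg : IsAlg g) : IsAlg fun s => f s * g s := by
  obtain ⟨F, hF, hF'⟩ := hf
  obtain ⟨G, hG, hG'⟩ := hg
  exact ⟨F * G, hF.mul hG, fun s => by simp [hF', hG']⟩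

theorem neg (hf : IsAlg f) : IsAlg fun s => -f s := by
  simpa using (const (-1)).mul hf

theorem sub (hf : IsAlg f) (hg : IsAlg g) : IsAlg fun s => f s - g s := by
  simpa [sub_eq_add_neg] using hf.add hg.neg

theorem sum {ι : Type*} (t : Finset ι) {f : ι → ℝ → ℂ} (hf : ∀ i ∈ t, IsAlg (f i)) :
    IsAlg fun s => ∑ i ∈ t, f i s := by
  classical
  induction t using Finset.induction_on with
  | empty => simpa using zero
  | insert i t hi ih =>
    simp only [Finset.sum_insert hi]
    exact (hf i (Finset.mem_insert_self i t)).add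
      (ih fun j hj => hf j (Finset.mem_insert_of_mem hj))

theorem star (hf : IsAlg f) : IsAlg fun s => star (f s) := by
  obtain ⟨F, hF, hF'⟩ := hf
  exact ⟨F, hF, fun s => by simp [hF']⟩

theorem inv (hf : IsAlg f) (h0 : ∀ s, f s ≠ 0) : IsAlg fun s => (f s)⁻¹ := by
  obtain ⟨F, hF, hF'⟩ := hf
  have hF0 : ∀ s, (F : ℝ → ℝ) s ≠ 0 := fun s h => h0 s (by simp [hF', h])
  let G : analyticFunctions := ⟨fun s => ((F : ℝ → ℝ) s)⁻¹,
    AnalyticOnNhd.inv F.2 fun s _ => hF0 s⟩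
  have hFG : F * G = 1 := Subtype.ext (funext fun s => mul_inv_cancel₀ (hF0 s))
  -- `F` and `F * G = 1` are algebraic and `F` is not a zero divisor, hence `G` is algebraic.
  refine ⟨G, IsAlgebraic.of_mul (mem_nonZeroDivisors_of_ne_zero fun h => hF0 0 ?_) hF ?_,
    fun s => by simp [hF', G]⟩
  · rw [h]; rfl
  · rw [hFG]; exact isAlgebraic_one

theorem sqrt {r : ℝ → ℝ} (hr : IsAlg fun s => (r s : ℂ)) (h0 : ∀ s, 0 < r s) :
    IsAlg fun s => (Real.sqrt (r s) : ℂ) := by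
  obtain ⟨F, hF, hF'⟩ := hr
  have hF' : ∀ s, r s = (F : ℝ → ℝ) s := fun s => Complex.ofReal_injective (hF' s)
  -- Writing the root as `exp (log F / 2)` makes it visibly analytic, since `F` is positive
  -- everywhere.
  let G : analyticFunctions := ⟨fun s => Real.exp (Real.log ((F : ℝ → ℝ) s) * 2⁻¹), fun s _ =>
    (((F.2 s trivial).log (hF' s ▸ h0 s)).mul analyticAt_const).rexp'⟩
  have hG : ∀ s, Real.sqrt (r s) = (G : ℝ → ℝ) s := fun s => by
    rw [Real.sqrt_eq_rpow, Real.rpow_def_of_pos (h0 s), hF' s]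
    simp [G]
  have hGF : G ^ 2 = F := Subtype.ext (funext fun s => by
    simp [← hG, ← hF', Real.sq_sqrt (h0 s).le])
  exact ⟨G, IsAlgebraic.of_pow two_pos (hGF ▸ hF), fun s => congrArg Complex.ofReal (hG s)⟩

theorem exp_natCast (n : ℕ) : IsAlg fun s => (Real.exp (n * s) : ℂ) := by
  refine ⟨algebraMap _ _ (Polynomial.X ^ n), isAlgebraic_algebraMap _, fun s => ?_⟩
  rw [algebraMap_analyticFunctions_apply, Polynomial.eval_pow, Polynomial.eval_X,
    ← Real.exp_nat_mul]

theorem exp_intCast (n : ℤ) : IsAlg fun s => (Real.exp (n * s) : ℂ) := by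
  obtain ⟨k, rfl | rfl⟩ := n.eq_nat_or_neg
  · simpa using exp_natCast k
  · refine ((exp_natCast k).inv fun s => ?_).congr fun s => ?_
    · exact_mod_cast (Real.exp_pos _).ne'
    · simp [Real.exp_neg]

/-- An algebraic function that is not identically zero has finitely many zeros. -/
theorem finite_zeros (hf : IsAlg f) (h : ∃ s, f s ≠ 0) : {s | f s = 0}.Finite := by
  obtain ⟨F, hF, hF'⟩ := hf
  have hF0 : F ≠ 0 := by
    rintro rfl
    obtain ⟨s, hs⟩ := h
    exact hs (by simp [hF'])
  -- In the domain of analytic functions, `F` divides a nonzero polynomial in `exp s`; zeros of `F`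
  -- therefore map injectively under `exp` to roots of `p`.
  obtain ⟨p, hp, G, hG⟩ := hF.exists_nonzero_dvd (mem_nonZeroDivisors_of_ne_zero hF0)
  refine Set.Finite.subset (p.roots.toFinset.finite_toSet.preimage Real.exp_injective.injOn) ?_
  intro s hs
  have hs' : (F : ℝ → ℝ) s = 0 := by
    have := hF' s
    rw [show f s = 0 from hs] at this
    exact_mod_cast this.symm
  have : p.eval (Real.exp s) = 0 := by
    rw [← algebraMap_analyticFunctions_apply, hG]
    simp [hs']
  simp [hp, this]

end IsAlg

/-- A family of matrices has algebraic entries. -/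
def AlgEntries {ι κ : Type*} (A : ℝ → Matrix ι κ ℂ) : Prop :=
  ∀ i j, IsAlg fun s => A s i j

namespace AlgEntries

variable {ι κ μ ν : Type*}

theorem one [DecidableEq ι] : AlgEntries fun _ => (1 : Matrix ι ι ℂ) := fun i j => by
  by_cases h : i = j
  · simpa [Matrix.one_apply, h] using IsAlg.one
  · simpa [Matrix.one_apply, h] using IsAlg.zero

theorem add {A B : ℝ → Matrix ι κ ℂ} (hA : AlgEntries A) (hB : AlgEntries B) :
    AlgEntries fun s => A s + B s := fun i j => (hA i j).add (hB i j)

theorem sub {A B : ℝ → Matrix ι κ ℂ} (hA : AlgEntries A) (hB : AlgEntries B) :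
    AlgEntries fun s => A s - B s := fun i j => (hA i j).sub (hB i j)

theorem smul {c : ℝ → ℂ} {A : ℝ → Matrix ι κ ℂ} (hc : IsAlg c) (hA : AlgEntries A) :
    AlgEntries fun s => c s • A s := fun i j => hc.mul (hA i j)

theorem mul [Fintype κ] {A : ℝ → Matrix ι κ ℂ} {B : ℝ → Matrix κ μ ℂ} (hA : AlgEntries A)
    (hB : AlgEntries B) : AlgEntries fun s => A s * B s := fun i j => by
  simp only [Matrix.mul_apply]
  exact IsAlg.sum _ fun k _ => (hA i k).mul (hB k j)

theorem kronecker {A : ℝ → Matrix ι κ ℂ} {B : ℝ → Matrix μ ν ℂ} (hA : AlgEntries A)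
    (hB : AlgEntries B) : AlgEntries fun s => A s ⊗ₖ B s := fun i j =>
  (hA i.1 j.1).mul (hB i.2 j.2)

theorem conjTranspose {A : ℝ → Matrix ι κ ℂ} (hA : AlgEntries A) :
    AlgEntries fun s => (A s).conjTranspose := fun i j => (hA j i).star

theorem trace [Fintype ι] {A : ℝ → Matrix ι ι ℂ} (hA : AlgEntries A) :
    IsAlg fun s => (A s).trace := IsAlg.sum _ fun i _ => hA i i

end AlgEntries

/-! ### Temperley-Lieb relations for multiples of a projection. -/

section

variable {n : ℕ}

theorem T12_mul (A B : Matrix (Fin n × Fin n) (Fin n × Fin n) ℂ) :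
    T12 (A * B) = T12 A * T12 B := by
  simp [T12, ← Matrix.mul_kronecker_mul]

theorem T23_mul (A B : Matrix (Fin n × Fin n) (Fin n × Fin n) ℂ) :
    T23 (A * B) = T23 A * T23 B := by
  simp [T23, Matrix.submatrix_mul_equiv, ← Matrix.mul_kronecker_mul]

theorem T12_smul (c : ℂ) (A : Matrix (Fin n × Fin n) (Fin n × Fin n) ℂ) :
    T12 (c • A) = c • T12 A := by
  simp [T12, Matrix.smul_kronecker]

theorem T23_smul (c : ℂ) (A : Matrix (Fin n × Fin n) (Fin n × Fin n) ℂ) :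
    T23 (c • A) = c • T23 A := by
  simp [T23, Matrix.kronecker_smul, Matrix.submatrix_smul]

theorem T12_conjTranspose (A : Matrix (Fin n × Fin n) (Fin n × Fin n) ℂ) :
    (T12 A).conjTranspose = T12 A.conjTranspose := by
  simp [T12, Matrix.conjTranspose_kronecker]

theorem T23_conjTranspose (A : Matrix (Fin n × Fin n) (Fin n × Fin n) ℂ) :
    (T23 A).conjTranspose = T23 A.conjTranspose := by
  simp [T23, Matrix.conjTranspose_kronecker, Matrix.conjTranspose_submatrix]

theorem T12_apply (A : Matrix (Fin n × Fin n) (Fin n × Fin n) ℂ) (a b c a' b' c' : Fin n) :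
    T12 A ((a, b), c) ((a', b'), c') = A (a, b) (a', b') * if c = c' then 1 else 0 := by
  simp [T12, Matrix.one_apply]

theorem T23_apply (A : Matrix (Fin n × Fin n) (Fin n × Fin n) ℂ) (a b c a' b' c' : Fin n) :
    T23 A ((a, b), c) ((a', b'), c') = (if a = a' then 1 else 0) * A (b, c) (b', c') := by
  simp [T23, Matrix.one_apply]

theorem trace_T12 (A : Matrix (Fin n × Fin n) (Fin n × Fin n) ℂ) :
    (T12 A).trace = n * A.trace := by
  simp [T12, Matrix.trace_kronecker, mul_comm]

theorem trace_T23 (A : Matrix (Fin n × Fin n) (Fin n × Fin n) ℂ) :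
    (T23 A).trace = n * A.trace := by
  have h : (T23 A).trace = ((1 : Matrix (Fin n) (Fin n) ℂ) ⊗ₖ A).trace :=
    Fintype.sum_equiv (Equiv.prodAssoc (Fin n) (Fin n) (Fin n)) _ _ fun _ => rfl
  simp [h, Matrix.trace_kronecker]

theorem T12_mul_T23_apply (A B : Matrix (Fin n × Fin n) (Fin n × Fin n) ℂ)
    (a b c a' b' c' : Fin n) :
    (T12 A * T23 B) ((a, b), c) ((a', b'), c') =
      ∑ y, A (a, b) (a', y) * B (y, c) (b', c') := by
  simp [Matrix.mul_apply, Fintype.sum_prod_type, T12_apply, T23_apply, Finset.sum_ite_eq]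

open scoped ComplexOrder in
theorem trace_conjTranspose_mul_self_pos {ι κ : Type*} [Fintype ι] [Fintype κ]
    {A : Matrix ι κ ℂ} (hA : A ≠ 0) : ∃ r : ℝ, 0 < r ∧ (A.conjTranspose * A).trace = r := by
  have h : 0 < (A.conjTranspose * A).trace :=
    lt_of_le_of_ne (Matrix.posSemidef_conjTranspose_mul_self A).trace_nonneg
      (fun h => hA (Matrix.trace_conjTranspose_mul_self_eq_zero_iff.mp h.symm))
  exact ⟨_, (Complex.pos_iff.mp h).1, Complex.ext rfl (Complex.pos_iff.mp h).2.symm⟩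

/-- The defect of `A` from being proportional to `B`, normalized by the traces. -/
def traceDefect {ι : Type*} [Fintype ι] (A B : Matrix ι ι ℂ) : Matrix ι ι ℂ :=
  B.trace • A - A.trace • B

theorem traceDefect_eq_zero_of_smul {ι : Type*} [Fintype ι] {A B : Matrix ι ι ℂ} {c : ℂ}
    (h : c • A = B) : traceDefect A B = 0 := by
  subst h
  simp [traceDefect, smul_smul, mul_comm]

/-- A multiple of an orthogonal projection `P` with `P₁₂ P₂₃ ≠ 0` solves the Temperley-Lieb
relations if and only if `P₁₂ P₂₃ P₁₂` is proportional to `P₁₂`, and likewise with the roles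
exchanged. -/
theorem exists_isTLSolution_iff {P : Matrix (Fin n × Fin n) (Fin n × Fin n) ℂ}
    (hP : P.conjTranspose = P) (hPP : P * P = P) (h0 : T12 P * T23 P ≠ 0) :
    (∃ Q : ℝ, 0 < Q ∧ IsTLSolution Q ((Q : ℂ) • P)) ↔
      traceDefect (T12 P * T23 P * T12 P) (T12 P) = 0 ∧
        traceDefect (T23 P * T12 P * T23 P) (T23 P) = 0 := by
  constructor
  · rintro ⟨Q, hQ, h⟩
    have hQ' : (Q : ℂ) ≠ 0 := by exact_mod_cast hQ.ne'
    have key : ∀ A B : Matrix ((Fin n × Fin n) × Fin n) ((Fin n × Fin n) × Fin n) ℂ,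
        ((Q : ℂ) • A) * ((Q : ℂ) • B) * ((Q : ℂ) • A) = (Q : ℂ) • A →
          (Q : ℂ) ^ 2 • (A * B * A) = A := fun A B h => by
      have h' := congrArg (fun M => (Q : ℂ)⁻¹ • M) h
      simp only [Matrix.smul_mul, Matrix.mul_smul, smul_smul, inv_mul_cancel₀ hQ', one_smul] at h'
      rw [← mul_assoc, inv_mul_cancel₀ hQ', one_mul, ← pow_two] at h'
      exact h'
    have h3 := h.t3
    have h4 := h.t4
    simp only [T12_smul, T23_smul] at h3 h4
    exact ⟨traceDefect_eq_zero_of_smul (key _ _ h3), traceDefect_eq_zero_of_smul (key _ _ h4)⟩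
  · rintro ⟨h1, h2⟩
    have e12 : T12 P * T12 P = T12 P := by rw [← T12_mul, hPP]
    have e23 : T23 P * T23 P = T23 P := by rw [← T23_mul, hPP]
    have s12 : (T12 P).conjTranspose = T12 P := by rw [T12_conjTranspose, hP]
    have s23 : (T23 P).conjTranspose = T23 P := by rw [T23_conjTranspose, hP]
    obtain ⟨x, hx, hx'⟩ := trace_conjTranspose_mul_self_pos h0
    obtain ⟨y, hy, hy'⟩ := trace_conjTranspose_mul_self_pos
      (A := T12 P) (fun h => h0 (by rw [h, zero_mul]))
    rw [s12, e12] at hy'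
    have hy'' : (T23 P).trace = y := by rw [← hy', trace_T12, trace_T23]
    -- Both triple products have trace `x`, and `P₁₂`, `P₂₃` both have trace `y`. So the two
    -- proportionality constants agree, and one `Q` with `Q ^ 2 = y / x` serves both cubic
    -- relations.
    have hY : (T23 P * T12 P * T23 P).trace = x := by
      rw [← hx', Matrix.conjTranspose_mul, s12, s23, mul_assoc, mul_assoc, ← mul_assoc (T12 P) (T12 P),
        e12]
    have hX : (T12 P * T23 P * T12 P).trace = x := by
      rw [← hY, Matrix.trace_mul_comm, ← mul_assoc, e12, Matrix.trace_mul_comm (_ * _) (T23 P),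
        ← mul_assoc, e23, Matrix.trace_mul_comm]
    rw [traceDefect, sub_eq_zero, hX, hy'] at h1
    rw [traceDefect, sub_eq_zero, hY, hy''] at h2
    have hx0 : (x : ℂ) ≠ 0 := by exact_mod_cast hx.ne'
    have hQ2 : ((Real.sqrt (y / x) : ℝ) : ℂ) ^ 2 * (x : ℂ) = y := by
      rw [← Complex.ofReal_pow, Real.sq_sqrt (by positivity), Complex.ofReal_div,
        div_mul_cancel₀ _ hx0]
    have key : ∀ A B : Matrix ((Fin n × Fin n) × Fin n) ((Fin n × Fin n) × Fin n) ℂ, ∀ Q : ℂ,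
        Q ^ 2 * x = y → (y : ℂ) • (A * B * A) = (x : ℂ) • A →
          (Q • A) * (Q • B) * (Q • A) = Q • A := fun A B Q hQ h => by
      have h' : Q ^ 2 • (A * B * A) = A := by
        apply smul_right_injective _ hx0
        simp only [smul_smul]
        rw [mul_comm, hQ, h]
      simp only [Matrix.smul_mul, Matrix.mul_smul, smul_smul]
      rw [← pow_two, mul_smul, h']
    refine ⟨Real.sqrt (y / x), Real.sqrt_pos.mpr (by positivity), ?_, ?_, ?_, ?_⟩
    · simp [hP]
    · simp [hPP]
    · simpa only [T12_smul, T23_smul] using key _ _ _ hQ2 h1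
    · simpa only [T12_smul, T23_smul] using key _ _ _ hQ2 h2

end

/-! ### Solving the eigenvalue equation by recursion. -/

/-- Along a family of eigenvectors supported on `S`, a matrix with algebraic entries that allows
to solve for the coordinates one after the other makes all of them algebraic multiples of the
first one. -/
theorem exists_isAlg_coordinate {ι : Type*} [Fintype ι] {C : ℝ → Matrix ι ι ℂ}
    (hC : AlgEntries C) {μ : ℝ → ℂ} (hμ : IsAlg μ) {v : ℝ → ι → ℂ}
    (hv : ∀ s, (C s).mulVec (v s) = μ s • v s) {S : Set ι} (hS : ∀ s p, p ∉ S → v s p = 0)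
    (pos : ι → ℕ) (p₀ : ι)
    (hstep : ∀ p ∈ S, p ≠ p₀ → ∃ r, pos r < pos p ∧ (∀ s, C s r p ≠ 0) ∧
      ∀ s, ∀ p' ∈ S, C s r p' ≠ 0 → p' = p ∨ pos p' < pos p) (p : ι) :
    ∃ g, IsAlg g ∧ ∀ s, v s p = g s * v s p₀ := by
  classical
  induction hk : pos p using Nat.strong_induction_on generalizing p with
  | _ k ih =>
    subst hk
    by_cases hpS : p ∉ S
    · exact ⟨_, IsAlg.zero, fun s => by simp [hS s p hpS]⟩
    by_cases hp : p = p₀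
    · exact ⟨_, IsAlg.one, fun s => by simp [hp]⟩
    obtain ⟨r, hr, hrp, hr'⟩ := hstep p (not_not.mp hpS) hp
    -- The function is chosen for all `p'`, with the default zero where the induction hypothesis is
    -- unavailable, so that `choose` applies.
    have : ∀ p', ∃ g, IsAlg g ∧ (pos p' < pos p → ∀ s, v s p' = g s * v s p₀) := fun p' => by
      by_cases h : pos p' < pos p
      · obtain ⟨g, hg, hg'⟩ := ih _ h p' rfl
        exact ⟨g, hg, fun _ => hg'⟩
      · exact ⟨_, IsAlg.zero, fun h' => absurd h' h⟩
    choose g hg hg' using this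
    let t : ι → ℝ → ℂ := fun p' s =>
      if p' ≠ p ∧ pos p' < pos p then C s r p' * g p' s else 0
    have ht : ∀ p', IsAlg (t p') := fun p' => by
      by_cases h : p' ≠ p ∧ pos p' < pos p
      · simpa only [t, if_pos h] using (hC r p').mul (hg p')
      · simpa only [t, if_neg h] using IsAlg.zero
    refine ⟨_, ((hC r p).inv hrp).mul ((hμ.mul (hg r)).sub (IsAlg.sum Finset.univ fun p' _ => ht p')),
      fun s => ?_⟩
    -- Row `r` involves, on the support, only `p` and positions already treated; its coefficient at
    -- `p` never vanishes, so it can be solved for `v s p`.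
    have hrow := congrFun (hv s) r
    simp only [Matrix.mulVec, dotProduct, Pi.smul_apply, smul_eq_mul] at hrow
    have hterm : ∀ p', C s r p' * v s p' =
        (if p' = p then C s r p * v s p else 0) + t p' s * v s p₀ := fun p' => by
      by_cases h1 : p' = p
      · simp [t, h1]
      by_cases h2 : pos p' < pos p
      · simp [t, h1, h2, hg' p' h2 s, mul_assoc]
      · have : C s r p' * v s p' = 0 := by
          by_cases h3 : p' ∈ S
          · rw [not_not.mp fun h => (hr' s p' h3 h).elim h1 h2, zero_mul]
          · rw [hS s p' h3, mul_zero]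
        simp [t, h1, h2, this]
    rw [Finset.sum_congr rfl fun p' _ => hterm p'] at hrow
    simp only [Finset.sum_add_distrib, ← Finset.sum_mul, Finset.sum_ite_eq',
      Finset.mem_univ, if_true] at hrow
    rw [hg' r hr s] at hrow
    rw [mul_assoc, eq_inv_mul_iff_mul_eq₀ (hrp s)]
    linear_combination hrow

/-! ### The `q`-numbers as functions of `s`. -/

theorem exp_two_mul_rpow (s t : ℝ) : Real.exp (2 * s) ^ t = Real.exp (2 * t * s) := by
  rw [← Real.exp_mul]
  ring_nf

theorem exp_two_mul_eq_one {s : ℝ} : Real.exp (2 * s) = 1 ↔ s = 0 := by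
  simp [Real.exp_eq_one_iff]

theorem exp_two_mul_sub_inv_ne_zero {s : ℝ} (hs : s ≠ 0) :
    Real.exp (2 * s) - (Real.exp (2 * s))⁻¹ ≠ 0 := by
  rw [← Real.exp_neg, sub_ne_zero]
  intro h
  have := Real.exp_injective h
  exact hs (by linarith)

/-- The symmetric geometric sum `q^(n-1) + ⋯ + q^(1-n)` covers `q = 1` as well, so no singularity
remains at `s = 0`. -/
theorem qNum_natCast (s : ℝ) (n : ℕ) :
    qNum (Real.exp (2 * s)) n =
      ∑ i ∈ Finset.range n, Real.exp ((2 * (n - 1 - 2 * i) : ℤ) * s) := by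
  simp only [qNum, exp_two_mul_eq_one]
  split_ifs with hs
  · simp [hs]
  · rw [div_eq_iff (exp_two_mul_sub_inv_ne_zero hs), Finset.sum_mul, exp_two_mul_rpow,
      exp_two_mul_rpow]
    have h := Finset.sum_range_sub' (fun i : ℕ => Real.exp (2 * (n - 2 * i) * s)) n
    have h1 : 2 * ((n : ℝ) - 2 * ((0 : ℕ) : ℝ)) * s = 2 * n * s := by push_cast; ring
    have h2 : 2 * ((n : ℝ) - 2 * n) * s = 2 * -n * s := by ring
    rw [h1, h2] at h
    rw [← h]
    refine Finset.sum_congr rfl fun i _ => ?_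
    rw [← Real.exp_neg, mul_sub (Real.exp _), ← Real.exp_add, ← Real.exp_add]
    push_cast
    ring_nf

theorem qNum_neg (q t : ℝ) : qNum q (-t) = -qNum q t := by
  unfold qNum
  split_ifs
  · rfl
  · rw [neg_neg, ← neg_div, neg_sub]

theorem qNum_natCast_pos (s : ℝ) {n : ℕ} (hn : 0 < n) : 0 < qNum (Real.exp (2 * s)) n := by
  rw [qNum_natCast]
  exact Finset.sum_pos (fun _ _ => Real.exp_pos _) ⟨0, by simpa using hn⟩

theorem isAlg_qNum_natCast (n : ℕ) : IsAlg fun s => (qNum (Real.exp (2 * s)) n : ℂ) := by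
  simp only [qNum_natCast, Complex.ofReal_sum]
  exact IsAlg.sum _ fun i _ => IsAlg.exp_intCast _

theorem isAlg_qNum_intCast (n : ℤ) : IsAlg fun s => (qNum (Real.exp (2 * s)) n : ℂ) := by
  obtain ⟨k, rfl | rfl⟩ := n.eq_nat_or_neg
  · simpa using isAlg_qNum_natCast k
  · simpa [qNum_neg] using (isAlg_qNum_natCast k).neg

/-! ### The generators and the tridiagonal operator `Δ(X⁻)Δ(X⁺)`. -/

section

variable {N : ℕ}

theorem algEntries_diagonal {ι : Type*} [DecidableEq ι] {d : ℝ → ι → ℂ}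
    (h : ∀ i, IsAlg fun s => d s i) : AlgEntries fun s => Matrix.diagonal (d s) := fun i j => by
  by_cases hij : i = j
  · simpa [hij] using h j
  · simpa [Matrix.diagonal_apply_ne _ hij] using IsAlg.zero

theorem algEntries_spinK : AlgEntries fun s => spinK N (Real.exp (2 * s)) :=
  algEntries_diagonal fun a => (IsAlg.exp_intCast (N - 2 * a)).congr fun s => by
    rw [exp_two_mul_rpow, weight]
    push_cast
    ring_nf

theorem algEntries_spinKinv : AlgEntries fun s => spinKinv N (Real.exp (2 * s)) :=
  algEntries_diagonal fun a => (IsAlg.exp_intCast (-(N - 2 * a))).congr fun s => by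
    rw [exp_two_mul_rpow, weight]
    push_cast
    ring_nf

theorem spinXp_apply (q : ℝ) (a b : Fin (N + 1)) :
    spinXp N q a b = if (b : ℕ) = a + 1 then
      ((Real.sqrt (qNum q (b : ℕ) * qNum q ((N + 1 - b : ℕ) : ℕ)) : ℝ) : ℂ) else 0 := by
  have h : (N : ℝ) / 2 + weight N b + 1 = ((N + 1 - b : ℕ) : ℕ) := by
    rw [Nat.cast_sub b.2.le, weight]
    push_cast
    ring
  rw [spinXp, Matrix.of_apply, h, weight, sub_sub_cancel]

theorem spinXp_factor_pos (s : ℝ) {a b : Fin (N + 1)} (h : (b : ℕ) = a + 1) :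
    0 < qNum (Real.exp (2 * s)) (b : ℕ) * qNum (Real.exp (2 * s)) ((N + 1 - b : ℕ) : ℕ) :=
  mul_pos (qNum_natCast_pos s (by omega)) (qNum_natCast_pos s (by omega))

theorem spinXp_ne_zero_iff (s : ℝ) {a b : Fin (N + 1)} :
    spinXp N (Real.exp (2 * s)) a b ≠ 0 ↔ (b : ℕ) = a + 1 := by
  rw [spinXp_apply]
  split_ifs with h
  · simpa [h, -mul_eq_zero] using (Real.sqrt_pos.mpr (spinXp_factor_pos s h)).ne'
  · simp [h]

theorem algEntries_spinXp : AlgEntries fun s => spinXp N (Real.exp (2 * s)) := fun a b => by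
  simp only [spinXp_apply]
  split_ifs with h
  · refine IsAlg.sqrt (r := fun s => qNum (Real.exp (2 * s)) (b : ℕ) *
      qNum (Real.exp (2 * s)) ((N + 1 - b : ℕ) : ℕ)) ?_ fun s => spinXp_factor_pos s h
    simp only [Complex.ofReal_mul]
    exact (isAlg_qNum_natCast _).mul (isAlg_qNum_natCast _)
  · exact IsAlg.zero

theorem algEntries_deltaXp : AlgEntries fun s => deltaXp N (Real.exp (2 * s)) :=
  (algEntries_spinXp.kronecker algEntries_spinK).add
    (algEntries_spinKinv.kronecker algEntries_spinXp)

theorem deltaXm_eq (q : ℝ) : deltaXm N q = (deltaXp N q).conjTranspose := by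
  have h1 : (spinK N q).conjTranspose = spinK N q := by
    simp [spinK, Matrix.diagonal_conjTranspose, Pi.star_def]
  have h2 : (spinKinv N q).conjTranspose = spinKinv N q := by
    simp [spinKinv, Matrix.diagonal_conjTranspose, Pi.star_def]
  rw [deltaXm, deltaXp, Matrix.conjTranspose_add, Matrix.conjTranspose_kronecker,
    Matrix.conjTranspose_kronecker, h1, h2, spinXm]

theorem algEntries_deltaXm_mul_deltaXp :
    AlgEntries fun s => deltaXm N (Real.exp (2 * s)) * deltaXp N (Real.exp (2 * s)) := by
  simp only [deltaXm_eq]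
  exact algEntries_deltaXp.conjTranspose.mul algEntries_deltaXp

theorem deltaXp_ne_zero_iff (s : ℝ) {k p : Fin (N + 1) × Fin (N + 1)} :
    deltaXp N (Real.exp (2 * s)) k p ≠ 0 ↔
      ((p.1 : ℕ) = k.1 + 1 ∧ p.2 = k.2) ∨ (p.1 = k.1 ∧ (p.2 : ℕ) = k.2 + 1) := by
  obtain ⟨a, b⟩ := k
  obtain ⟨c, d⟩ := p
  simp only [deltaXp, Matrix.add_apply, Matrix.kroneckerMap_apply]
  by_cases h1 : c = a
  · subst h1
    have : spinXp N (Real.exp (2 * s)) c c = 0 :=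
      not_not.mp ((spinXp_ne_zero_iff s).not.mpr (by omega))
    have hK : spinKinv N (Real.exp (2 * s)) c c ≠ 0 := by
      simp [spinKinv, (Real.rpow_pos_of_pos (Real.exp_pos _) _).ne']
    simp [this, hK, ← spinXp_ne_zero_iff s]
  · have : spinKinv N (Real.exp (2 * s)) a c = 0 := Matrix.diagonal_apply_ne' _ h1
    have hK : spinK N (Real.exp (2 * s)) b d ≠ 0 ↔ d = b := by
      by_cases h2 : d = b
      · simp [spinK, h2, (Real.rpow_pos_of_pos (Real.exp_pos _) _).ne']
      · simp [spinK, h2, Matrix.diagonal_apply_ne' _ h2]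
    simp only [this, h1, zero_mul, add_zero, mul_ne_zero_iff, hK, spinXp_ne_zero_iff, false_and,
      or_false]

theorem deltaXm_mul_deltaXp_apply (q : ℝ) (r p : Fin (N + 1) × Fin (N + 1)) :
    (deltaXm N q * deltaXp N q) r p = ∑ k, star (deltaXp N q k r) * deltaXp N q k p := by
  simp [deltaXm_eq, Matrix.mul_apply]

theorem le_of_deltaXm_mul_deltaXp_ne_zero {s : ℝ} {r p : Fin (N + 1) × Fin (N + 1)}
    (h : (deltaXm N (Real.exp (2 * s)) * deltaXp N (Real.exp (2 * s))) r p ≠ 0) :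
    (p.1 : ℕ) ≤ r.1 + 1 ∧ (p.2 : ℕ) ≤ r.2 + 1 := by
  rw [deltaXm_mul_deltaXp_apply] at h
  obtain ⟨k, -, hk⟩ := Finset.exists_ne_zero_of_sum_ne_zero h
  rw [mul_ne_zero_iff, star_ne_zero, deltaXp_ne_zero_iff, deltaXp_ne_zero_iff] at hk
  simp only [Fin.ext_iff] at hk
  omega

/-- Two distinct basis vectors have at most one common target under `Δ(X⁺)`, so the sum for this
entry has a single nonzero term and nothing cancels. -/
theorem deltaXm_mul_deltaXp_ne_zero (s : ℝ) {k r p : Fin (N + 1) × Fin (N + 1)} (hrp : r ≠ p)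
    (hr : deltaXp N (Real.exp (2 * s)) k r ≠ 0) (hp : deltaXp N (Real.exp (2 * s)) k p ≠ 0) :
    (deltaXm N (Real.exp (2 * s)) * deltaXp N (Real.exp (2 * s))) r p ≠ 0 := by
  rw [deltaXm_mul_deltaXp_apply, Finset.sum_eq_single k]
  · exact mul_ne_zero (star_ne_zero.mpr hr) hp
  · intro l _ hl
    by_contra hne
    rw [← ne_eq, mul_ne_zero_iff, star_ne_zero, deltaXp_ne_zero_iff, deltaXp_ne_zero_iff] at hne
    rw [deltaXp_ne_zero_iff] at hr hp
    simp only [Fin.ext_iff, Prod.ext_iff, ne_eq] at *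
    omega
  · simp

end

/-! ### Weights, the Casimir element and the joint eigenvectors. -/

/-- The weight of a vector of the canonical basis of the tensor square. -/
def totalWeight {N : ℕ} (p : Fin (N + 1) × Fin (N + 1)) : ℤ := N - p.1 - p.2

theorem weight_add_weight {N : ℕ} (p : Fin (N + 1) × Fin (N + 1)) :
    weight N p.1 + weight N p.2 = totalWeight p := by
  simp only [weight, totalWeight]
  push_cast
  ring

theorem deltaH_eq (N : ℕ) :
    deltaH N = Matrix.diagonal fun p => ((totalWeight p : ℤ) : ℂ) := by
  have h : ∀ p : Fin (N + 1) × Fin (N + 1), ((totalWeight p : ℤ) : ℂ) =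
      ((weight N p.1 : ℝ) : ℂ) * 1 + 1 * ((weight N p.2 : ℝ) : ℂ) := fun p => by
    rw [mul_one, one_mul]
    exact_mod_cast (weight_add_weight p).symm
  rw [funext h, deltaH, spinH, ← Matrix.diagonal_one, Matrix.diagonal_kronecker_diagonal,
    Matrix.diagonal_kronecker_diagonal, Matrix.diagonal_add]

theorem deltaK_eq (N : ℕ) {q : ℝ} (hq : 0 < q) :
    deltaK N q = Matrix.diagonal fun p => ((q ^ totalWeight p : ℝ) : ℂ) := by
  rw [deltaK, spinK, Matrix.diagonal_kronecker_diagonal]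
  congr 1
  funext p
  rw [← Complex.ofReal_mul, ← Real.rpow_add hq, weight_add_weight, Real.rpow_intCast]

theorem deltaKinv_eq (N : ℕ) {q : ℝ} (hq : 0 < q) :
    deltaKinv N q = Matrix.diagonal fun p => ((q ^ (-totalWeight p) : ℝ) : ℂ) := by
  rw [deltaKinv, spinKinv, Matrix.diagonal_kronecker_diagonal]
  congr 1
  funext p
  rw [← Complex.ofReal_mul, ← Real.rpow_add hq, ← neg_add, weight_add_weight, ← Int.cast_neg,
    Real.rpow_intCast]

/-- The Cartan part of the Casimir is `[m]_q [m+1]_q` on weight `m`, in one formula for `q = 1` and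
`q ≠ 1`. On a weight space only `Δ(X⁻)Δ(X⁺)` is not scalar. -/
theorem deltaC_eq (N : ℕ) {q : ℝ} (hq : 0 < q) :
    deltaC N q = deltaXm N q * deltaXp N q + Matrix.diagonal fun p =>
      ((qNum q (totalWeight p : ℤ) * qNum q ((totalWeight p : ℤ) + 1) : ℝ) : ℂ) := by
  rw [deltaC]
  split_ifs with h
  · congr 1
    rw [deltaH_eq, ← Matrix.diagonal_one, Matrix.diagonal_add, Matrix.diagonal_mul_diagonal]
    congr 1
    funext p
    simp [qNum, h]
  · congr 1
    rw [deltaK_eq N hq, deltaKinv_eq N hq, Matrix.diagonal_sub, ← Matrix.diagonal_smul,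
      ← Matrix.diagonal_smul, Matrix.diagonal_sub, Matrix.diagonal_mul_diagonal,
      ← Matrix.diagonal_smul]
    congr 1
    funext p
    have h1 : ((totalWeight p : ℤ) : ℝ) + 1 = ((totalWeight p + 1 : ℤ) : ℝ) := by push_cast; rfl
    simp only [qNum, if_neg h, h1, ← Int.cast_neg, Real.rpow_intCast, Pi.smul_apply, smul_eq_mul]
    rw [neg_add, zpow_add₀ hq.ne', zpow_add₀ hq.ne', zpow_one, zpow_neg_one]
    push_cast
    rw [div_mul_div_comm, div_eq_inv_mul, pow_two]
    ring

namespace IsJointEigenvector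

variable {N J : ℕ} {m : ℤ} {q : ℝ} {v : EuclideanSpace ℂ (Fin (N + 1) × Fin (N + 1))}

theorem totalWeight_eq (h : IsJointEigenvector N q J m v) (hq : 0 < q)
    {p : Fin (N + 1) × Fin (N + 1)} (hp : v p ≠ 0) : totalWeight p = m := by
  have hw := h.weight_eq
  split_ifs at hw with h1
  · have := congrArg (fun w => w p) hw
    simp only [Matrix.ofLp_toLpLin, Matrix.toLin'_apply, deltaH_eq, Matrix.mulVec_diagonal,
      PiLp.smul_apply, smul_eq_mul] at this
    exact Int.cast_injective (mul_right_cancel₀ hp this)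
  · have := congrArg (fun w => w p) hw
    simp only [Matrix.ofLp_toLpLin, Matrix.toLin'_apply, deltaK_eq N hq, Matrix.mulVec_diagonal,
      PiLp.smul_apply, smul_eq_mul] at this
    exact zpow_right_injective₀ hq h1 (Complex.ofReal_injective (mul_right_cancel₀ hp this))

theorem mulVec_eq (h : IsJointEigenvector N q J m v) (hq : 0 < q) :
    (deltaXm N q * deltaXp N q).mulVec v.ofLp =
      ((qNum q J * qNum q (J + 1) - qNum q m * qNum q (m + 1) : ℝ) : ℂ) • v.ofLp := by
  funext p
  have := congrArg (fun w => w p) h.casimir_eq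
  simp only [Matrix.ofLp_toLpLin, Matrix.toLin'_apply, deltaC_eq N hq, Matrix.add_mulVec, Pi.add_apply,
    Matrix.mulVec_diagonal, PiLp.smul_apply, smul_eq_mul] at this
  rw [Pi.smul_apply, smul_eq_mul, Complex.ofReal_sub, sub_mul, ← this]
  by_cases hp : v p = 0
  · simp [hp]
  · rw [h.totalWeight_eq hq hp, add_sub_cancel_right]

end IsJointEigenvector

/-- Up to a scalar, the joint eigenvectors have coordinates that are algebraic functions of the
deformation parameter; their two extreme coordinates do not vanish. -/
theorem exists_isAlg_coordinates {N J : ℕ} {m : ℤ} (hJ : J ≤ N) (hm : |m| ≤ (J : ℤ))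
    {ψ : ℝ → EuclideanSpace ℂ (Fin (N + 1) × Fin (N + 1))}
    (hψ : ∀ q, 0 < q → IsJointEigenvector N q J m (ψ q)) :
    ∃ (g : Fin (N + 1) × Fin (N + 1) → ℝ → ℂ) (a b : Fin (N + 1)), (∀ p, IsAlg (g p)) ∧
      ∀ s, (∀ p, ψ (Real.exp (2 * s)) p = g p s * ψ (Real.exp (2 * s)) (a, b)) ∧
        ψ (Real.exp (2 * s)) (a, b) ≠ 0 ∧ ψ (Real.exp (2 * s)) (b, a) ≠ 0 ∧
        ∀ y, ψ (Real.exp (2 * s)) (a, y) ≠ 0 → y = b := by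
  obtain ⟨hm1, hm2⟩ := abs_le.mp hm
  -- In weight `m` the indices sum to `N - m`; `a = max (-m) 0` is the least possible index and `b`
  -- the greatest, so `(a, b)` and `(b, a)` are the two ends of the chain.
  let a : Fin (N + 1) := ⟨(-m).toNat, by omega⟩
  let b : Fin (N + 1) := ⟨(N - m - (-m).toNat).toNat, by omega⟩
  have hψ' := fun s => hψ (Real.exp (2 * s)) (Real.exp_pos _)
  have hw : ∀ s p, totalWeight p ≠ m → ψ (Real.exp (2 * s)) p = 0 := fun s p hp => by
    by_contra h
    exact hp ((hψ' s).totalWeight_eq (Real.exp_pos _) h)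
  have hv := fun s => (hψ' s).mulVec_eq (Real.exp_pos _)
  have hμ : IsAlg fun s => ((qNum (Real.exp (2 * s)) J * qNum (Real.exp (2 * s)) (J + 1) -
      qNum (Real.exp (2 * s)) m * qNum (Real.exp (2 * s)) (m + 1) : ℝ) : ℂ) := by
    have h1 := (isAlg_qNum_natCast J).mul (isAlg_qNum_natCast (J + 1))
    have h2 := (isAlg_qNum_intCast m).mul (isAlg_qNum_intCast (m + 1))
    simpa using h1.sub h2
  have h1 := exists_isAlg_coordinate algEntries_deltaXm_mul_deltaXp hμ hv
    (S := {p | totalWeight p = m}) hw (fun p => (p.1 : ℕ)) (a, b) (by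
      intro p hp hpa
      simp only [Set.mem_ofPred_eq, totalWeight, a, b, ne_eq, Prod.ext_iff, Fin.ext_iff] at hp hpa
      have hp1 := p.1.2
      have hp2 := p.2.2
      -- The neighbour one step nearer to `(a, b)`. `Δ(X⁺)` sends both `p` and `r` to a combination
      -- containing `(r.1, p.2)`.
      let r : Fin (N + 1) × Fin (N + 1) := (⟨p.1 - 1, by omega⟩, ⟨p.2 + 1, by omega⟩)
      refine ⟨r, by simp only [r]; omega, fun s => ?_, fun s p' hp' hne => ?_⟩
      · refine deltaXm_mul_deltaXp_ne_zero s (k := (r.1, p.2)) ?_ ?_ ?_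
        · simp only [r, ne_eq, Prod.ext_iff, Fin.ext_iff]
          omega
        · simp [deltaXp_ne_zero_iff, r]
        · rw [deltaXp_ne_zero_iff]
          simp only [r, and_true]
          omega
      · have := (le_of_deltaXm_mul_deltaXp_ne_zero hne).1
        simp only [r, Set.mem_ofPred_eq, totalWeight, Prod.ext_iff, Fin.ext_iff] at this hp' ⊢
        omega)
  -- The same recursion from the opposite end, needed only for the nonvanishing at `(b, a)`.
  have h2 := exists_isAlg_coordinate algEntries_deltaXm_mul_deltaXp hμ hv
    (S := {p | totalWeight p = m}) hw (fun p => (p.2 : ℕ)) (b, a) (by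
      intro p hp hpa
      simp only [Set.mem_ofPred_eq, totalWeight, a, b, ne_eq, Prod.ext_iff, Fin.ext_iff] at hp hpa
      have hp1 := p.1.2
      have hp2 := p.2.2
      let r : Fin (N + 1) × Fin (N + 1) := (⟨p.1 + 1, by omega⟩, ⟨p.2 - 1, by omega⟩)
      refine ⟨r, by simp only [r]; omega, fun s => ?_, fun s p' hp' hne => ?_⟩
      · refine deltaXm_mul_deltaXp_ne_zero s (k := (p.1, r.2)) ?_ ?_ ?_
        · simp only [r, ne_eq, Prod.ext_iff, Fin.ext_iff]
          omega
        · simp [deltaXp_ne_zero_iff, r]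
        · rw [deltaXp_ne_zero_iff]
          simp only [r, true_and]
          omega
      · have := (le_of_deltaXm_mul_deltaXp_ne_zero hne).2
        simp only [r, Set.mem_ofPred_eq, totalWeight, Prod.ext_iff, Fin.ext_iff] at this hp' ⊢
        omega)
  choose g hg hg' using h1
  refine ⟨g, a, b, hg, fun s => ⟨fun p => hg' p s, fun h => ?_, fun h => ?_, fun y hy => ?_⟩⟩
  · refine (hψ' s).ne_zero (PiLp.ext fun p => ?_)
    simpa [h] using hg' p s
  · refine (hψ' s).ne_zero (PiLp.ext fun p => ?_)
    obtain ⟨g', -, hg''⟩ := h2 p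
    simpa [h] using hg'' s
  · have := (hψ' s).totalWeight_eq (Real.exp_pos _) hy
    simp only [totalWeight, a, b, Fin.ext_iff] at this ⊢
    omega

/-! ### Projection matrices and the dichotomy. -/

section

/-- The matrix `g g^* / (g^* g)` of the orthogonal projection onto the line spanned by `g`. -/
def lineProj {ι : Type*} [Fintype ι] (g : ι → ℂ) : Matrix ι ι ℂ :=
  (∑ k, g k * star (g k))⁻¹ • Matrix.vecMulVec g (star g)

open scoped ComplexOrder in
theorem sum_mul_star_ne_zero {ι : Type*} [Fintype ι] {g : ι → ℂ} {p : ι} (hp : g p ≠ 0) :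
    ∑ k, g k * star (g k) ≠ 0 := fun h =>
  hp (congrFun (dotProduct_star_self_eq_zero.mp ((dotProduct_comm _ _).trans h)) p)

/-- Normalization removes the arbitrary dependence of the eigenvector's scale on `q`. -/
theorem lineProj_smul {ι : Type*} [Fintype ι] {c : ℂ} (hc : c ≠ 0) (g : ι → ℂ) :
    lineProj (c • g) = lineProj g := by
  have h : ∑ k, (c • g) k * star ((c • g) k) = (c * star c) * ∑ k, g k * star (g k) := by
    rw [Finset.mul_sum]
    exact Finset.sum_congr rfl fun k _ => by simp; ring
  have hc' : star c ≠ 0 := star_ne_zero.mpr hc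
  rw [lineProj, h]
  ext i j
  simp only [lineProj, Matrix.smul_apply, Matrix.vecMulVec_apply, Pi.smul_apply, Pi.star_apply,
    smul_eq_mul, star_mul, mul_inv]
  field_simp

variable {n : ℕ}

set_option synthInstance.maxHeartbeats 200000 in
theorem projMatrix_conjTranspose (U : Submodule ℂ (EuclideanSpace ℂ (Fin n × Fin n))) :
    (projMatrix U).conjTranspose = projMatrix U := by
  rw [projMatrix, ← Matrix.star_eq_conjTranspose, ← map_star,
    (isSelfAdjoint_starProjection U).star_eq]

theorem projMatrix_mul_of_le {U V : Submodule ℂ (EuclideanSpace ℂ (Fin n × Fin n))} (h : U ≤ V) :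
    projMatrix U * projMatrix V = projMatrix U := by
  rw [projMatrix, projMatrix, ← map_mul]
  exact congrArg _ (Submodule.starProjection_comp_starProjection_of_le h)

theorem mul_projMatrix_of_le {U V : Submodule ℂ (EuclideanSpace ℂ (Fin n × Fin n))} (h : U ≤ V) :
    projMatrix V * projMatrix U = projMatrix U := by
  have := congrArg Matrix.conjTranspose (projMatrix_mul_of_le h)
  rwa [Matrix.conjTranspose_mul, projMatrix_conjTranspose, projMatrix_conjTranspose] at this

theorem projMatrix_span_singleton (v : EuclideanSpace ℂ (Fin n × Fin n)) :
    projMatrix (Submodule.span ℂ {v}) = lineProj v.ofLp := by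
  rw [projMatrix, StarAlgEquiv.symm_apply_eq]
  ext w p
  have h : ((‖v‖ ^ 2 : ℝ) : ℂ) = ∑ k, v k * star (v k) := by
    rw [EuclideanSpace.norm_sq_eq, Complex.ofReal_sum]
    exact Finset.sum_congr rfl fun k _ => by
      rw [Complex.ofReal_pow]; exact (Complex.mul_conj' _).symm
  rw [Submodule.starProjection_singleton, Matrix.ofLp_toEuclideanCLM, lineProj, ← h,
    Matrix.smul_mulVec, Matrix.vecMulVec_mulVec, EuclideanSpace.inner_eq_star_dotProduct,
    dotProduct_comm]
  simp [div_eq_inv_mul, mul_assoc]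

theorem projMatrix_span_pair {v w : EuclideanSpace ℂ (Fin n × Fin n)} (h : inner ℂ v w = 0) :
    projMatrix (Submodule.span ℂ {v, w}) = lineProj v.ofLp + lineProj w.ofLp := by
  rw [← projMatrix_span_singleton, ← projMatrix_span_singleton, projMatrix, projMatrix, projMatrix,
    ← map_add]
  congr 1
  ext1 x
  have h' : inner ℂ w v = 0 := inner_eq_zero_symm.mp h
  have hres : ∀ u : EuclideanSpace ℂ (Fin n × Fin n),
      inner ℂ (x - (Submodule.span ℂ {u}).starProjection x) u = 0 := fun u =>
    Submodule.starProjection_inner_eq_zero (K := Submodule.span ℂ {u}) x u (Submodule.mem_span_singleton_self u)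
  refine Submodule.eq_starProjection_of_mem_orthogonal (K := Submodule.span ℂ {v, w}) ?_ ?_
  · exact add_mem
      (Submodule.span_mono (by simp) (Submodule.starProjection_apply_mem (Submodule.span ℂ {v}) x))
      (Submodule.span_mono (by simp) (Submodule.starProjection_apply_mem (Submodule.span ℂ {w}) x))
  · rw [Submodule.mem_orthogonal']
    intro u hu
    obtain ⟨α, β, rfl⟩ := Submodule.mem_span_pair.mp hu
    have h1 := hres v
    have h2 := hres w
    simp only [Submodule.starProjection_singleton, add_apply, inner_sub_left,
      inner_add_left, inner_add_right, inner_smul_left, inner_smul_right, h, h', mul_zero,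
      add_zero, zero_add] at h1 h2 ⊢
    linear_combination α * h1 + β * h2

/-- If a subspace contains a vector `v` with suitable nonzero coordinates, then its projection
satisfies `P₁₂ P₂₃ ≠ 0`. -/
theorem T12_mul_T23_projMatrix_ne_zero {U : Submodule ℂ (EuclideanSpace ℂ (Fin n × Fin n))}
    {v : EuclideanSpace ℂ (Fin n × Fin n)} (hv : v ∈ U) {a b : Fin n} (hab : v (a, b) ≠ 0)
    (hba : v (b, a) ≠ 0) (hay : ∀ y, v (a, y) ≠ 0 → y = b) :
    T12 (projMatrix U) * T23 (projMatrix U) ≠ 0 := by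
  intro h
  have hle : Submodule.span ℂ {v} ≤ U := (Submodule.span_singleton_le_iff_mem v U).mpr hv
  -- Let `p` be the projection onto the line of `v`. From `p = p P = P p` one gets `p₁₂ p₂₃ = p₁₂
  -- (P₁₂ P₂₃) p₂₃ = 0`, which reduces the claim to a line.
  have h0 : T12 (lineProj v.ofLp) * T23 (lineProj v.ofLp) = 0 := by
    rw [← projMatrix_span_singleton, ← projMatrix_mul_of_le hle, T12_mul,
      projMatrix_mul_of_le hle]
    nth_rw 2 [← mul_projMatrix_of_le hle]
    rw [T23_mul, mul_assoc, ← mul_assoc (T12 (projMatrix U)), h, zero_mul, mul_zero]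
  have hN : (∑ k, v k * star (v k)) ≠ 0 := sum_mul_star_ne_zero hab
  -- By `hay` only `y = b` survives in this diagonal entry, which is `|v (a, b)|² |v (b, a)|²` up to
  -- normalization.
  have h1 := congrFun (congrFun h0 ((a, b), a)) ((a, b), a)
  rw [T12_mul_T23_apply, Finset.sum_eq_single b] at h1
  · simp [lineProj, Matrix.vecMulVec_apply, hab, hba] at h1
    exact hN h1
  · intro y _ hy
    have : v (a, y) = 0 := not_not.mp fun h => hy (hay y h)
    simp [lineProj, Matrix.vecMulVec_apply, this]
  · simp

theorem algEntries_lineProj {ι : Type*} [Fintype ι] {g : ι → ℝ → ℂ} (hg : ∀ p, IsAlg (g p))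
    (h0 : ∀ s, ∃ p, g p s ≠ 0) : AlgEntries fun s => lineProj fun p => g p s := by
  intro i j
  refine ((IsAlg.sum Finset.univ fun k _ => (hg k).mul (hg k).star).inv fun s => ?_).mul
    ((hg i).mul (hg j).star)
  obtain ⟨p, hp⟩ := h0 s
  exact sum_mul_star_ne_zero (g := fun p => g p s) hp

theorem algEntries_T12 {P : ℝ → Matrix (Fin n × Fin n) (Fin n × Fin n) ℂ} (hP : AlgEntries P) :
    AlgEntries fun s => T12 (P s) := hP.kronecker AlgEntries.one

theorem algEntries_T23 {P : ℝ → Matrix (Fin n × Fin n) (Fin n × Fin n) ℂ} (hP : AlgEntries P) :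
    AlgEntries fun s => T23 (P s) := fun i j =>
  (AlgEntries.one.kronecker hP) (Equiv.prodAssoc _ _ _ i) (Equiv.prodAssoc _ _ _ j)

theorem algEntries_traceDefect {ι : Type*} [Fintype ι] {A B : ℝ → Matrix ι ι ℂ}
    (hA : AlgEntries A) (hB : AlgEntries B) : AlgEntries fun s => traceDefect (A s) (B s) :=
  (AlgEntries.smul hB.trace hA).sub (AlgEntries.smul hA.trace hB)

theorem forall_eq_zero_or_finite {ι κ : Type*} {A : ℝ → Matrix ι κ ℂ} (hA : AlgEntries A) :
    (∀ s, A s = 0) ∨ {s | A s = 0}.Finite := by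
  refine or_iff_not_imp_left.mpr fun h => ?_
  push Not at h
  obtain ⟨s, hs⟩ := h
  obtain ⟨i, j, hij⟩ : ∃ i j, A s i j ≠ 0 := by
    by_contra! h
    exact hs (Matrix.ext h)
  exact ((hA i j).finite_zeros ⟨s, hij⟩).subset fun t (ht : A t = 0) => by simp [ht]

/-- For subspaces depending algebraically on the deformation parameter, being a solution of the
Temperley-Lieb relations is a generic or a finite property. -/
theorem forall_isTLSolution_or_finite
    {U : ℝ → Submodule ℂ (EuclideanSpace ℂ (Fin n × Fin n))}
    (hU : AlgEntries fun s => projMatrix (U (Real.exp (2 * s))))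
    (h0 : ∀ q, 0 < q → T12 (projMatrix (U q)) * T23 (projMatrix (U q)) ≠ 0) :
    (∀ q : ℝ, 0 < q → ∃ Q : ℝ, 0 < Q ∧ IsTLSolution Q ((Q : ℂ) • projMatrix (U q))) ∨
      {q : ℝ | 0 < q ∧ ∃ Q : ℝ, 0 < Q ∧ IsTLSolution Q ((Q : ℂ) • projMatrix (U q))}.Finite := by
  have hiff := fun q hq => exists_isTLSolution_iff (projMatrix_conjTranspose (U q))
    (projMatrix_mul_of_le le_rfl) (h0 q hq)
  have h12 := algEntries_T12 hU
  have h23 := algEntries_T23 hU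
  have hlog : ∀ q : ℝ, 0 < q → Real.exp (2 * (Real.log q / 2)) = q := fun q hq => by
    rw [mul_div_cancel₀ _ two_ne_zero, Real.exp_log hq]
  have hfin : ∀ t : Set ℝ, t.Finite → (∀ q, 0 < q →
      (∃ Q : ℝ, 0 < Q ∧ IsTLSolution Q ((Q : ℂ) • projMatrix (U q))) → Real.log q / 2 ∈ t) →
      {q : ℝ | 0 < q ∧ ∃ Q : ℝ, 0 < Q ∧
        IsTLSolution Q ((Q : ℂ) • projMatrix (U q))}.Finite := fun t ht h =>
    (ht.image fun s => Real.exp (2 * s)).subset fun q hq => ⟨_, h q hq.1 hq.2, hlog q hq.1⟩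
  rcases forall_eq_zero_or_finite (algEntries_traceDefect ((h12.mul h23).mul h12) h12) with h1 | h1
  · rcases forall_eq_zero_or_finite (algEntries_traceDefect ((h23.mul h12).mul h23) h23) with
      h2 | h2
    · refine Or.inl fun q hq => (hiff q hq).mpr ?_
      have h1' := h1 (Real.log q / 2)
      have h2' := h2 (Real.log q / 2)
      rw [hlog q hq] at h1' h2'
      exact ⟨h1', h2'⟩
    · refine Or.inr (hfin _ h2 fun q hq h => ?_)
      simpa only [Set.mem_ofPred_eq, hlog q hq] using ((hiff q hq).mp h).2
  · refine Or.inr (hfin _ h1 fun q hq h => ?_)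
    simpa only [Set.mem_ofPred_eq, hlog q hq] using ((hiff q hq).mp h).1

theorem algEntries_lineProj_of_coordinates {ψ : ℝ → EuclideanSpace ℂ (Fin n × Fin n)}
    {g : Fin n × Fin n → ℝ → ℂ} (hg : ∀ p, IsAlg (g p)) {p₀ : Fin n × Fin n}
    (hψ : ∀ s, ∀ p, ψ (Real.exp (2 * s)) p = g p s * ψ (Real.exp (2 * s)) p₀)
    (h0 : ∀ s, ψ (Real.exp (2 * s)) p₀ ≠ 0) :
    AlgEntries fun s => lineProj (ψ (Real.exp (2 * s))).ofLp := by
  have h : ∀ s, lineProj (ψ (Real.exp (2 * s))).ofLp = lineProj fun p => g p s := fun s => by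
    refine Eq.trans (congrArg lineProj (funext fun p => ?_)) (lineProj_smul (h0 s) _)
    rw [hψ s p, Pi.smul_apply, smul_eq_mul, mul_comm]
  simp only [h]
  refine algEntries_lineProj hg fun s => ⟨p₀, fun h => h0 s ?_⟩
  rw [hψ s p₀, h, zero_mul]

theorem T12_mul_T23_projMatrix_ne_zero_of_eigenvector {N J : ℕ} {m : ℤ} (hJ : J ≤ N)
    (hm : |m| ≤ (J : ℤ)) {ψ : ℝ → EuclideanSpace ℂ (Fin (N + 1) × Fin (N + 1))}
    (hψ : ∀ q, 0 < q → IsJointEigenvector N q J m (ψ q)) {q : ℝ} (hq : 0 < q)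
    {U : Submodule ℂ (EuclideanSpace ℂ (Fin (N + 1) × Fin (N + 1)))} (hU : ψ q ∈ U) :
    T12 (projMatrix U) * T23 (projMatrix U) ≠ 0 := by
  obtain ⟨g, a, b, -, h⟩ := exists_isAlg_coordinates hJ hm hψ
  obtain ⟨-, hab, hba, hay⟩ := h (Real.log q / 2)
  rw [mul_div_cancel₀ _ two_ne_zero, Real.exp_log hq] at hab hba
  simp only [mul_div_cancel₀ _ (two_ne_zero' ℝ), Real.exp_log hq] at hay
  exact T12_mul_T23_projMatrix_ne_zero hU hab hba hay

theorem algEntries_lineProj_of_eigenvector {N J : ℕ} {m : ℤ} (hJ : J ≤ N)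
    (hm : |m| ≤ (J : ℤ)) {ψ : ℝ → EuclideanSpace ℂ (Fin (N + 1) × Fin (N + 1))}
    (hψ : ∀ q, 0 < q → IsJointEigenvector N q J m (ψ q)) :
    AlgEntries fun s => lineProj (ψ (Real.exp (2 * s))).ofLp := by
  obtain ⟨g, a, b, hg, h⟩ := exists_isAlg_coordinates hJ hm hψ
  exact algEntries_lineProj_of_coordinates hg (fun s => (h s).1) fun s => (h s).2.1

end

end TLUq

end

theorem proposition7 (N : ℕ) :
    (∀ (J : ℕ) (m : ℤ), J ≤ N → |m| ≤ (J : ℤ) →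
      ∀ ψ : ℝ → EuclideanSpace ℂ (Fin (N + 1) × Fin (N + 1)),
        (∀ q : ℝ, 0 < q → TLUq.IsJointEigenvector N q J m (ψ q)) →
        (∀ q : ℝ, 0 < q → TLUq.IsTLVector (ψ q)) ∨
          {q : ℝ | 0 < q ∧ TLUq.IsTLVector (ψ q)}.Finite) ∧
    (∀ (J₁ J₂ : ℕ) (m₁ m₂ : ℤ), J₁ ≤ N → |m₁| ≤ (J₁ : ℤ) → J₂ ≤ N → |m₂| ≤ (J₂ : ℤ) →
      ∀ ψ₁ ψ₂ : ℝ → EuclideanSpace ℂ (Fin (N + 1) × Fin (N + 1)),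
        (∀ q : ℝ, 0 < q → TLUq.IsJointEigenvector N q J₁ m₁ (ψ₁ q)) →
        (∀ q : ℝ, 0 < q → TLUq.IsJointEigenvector N q J₂ m₂ (ψ₂ q)) →
        (∀ q : ℝ, 0 < q → inner ℂ (ψ₁ q) (ψ₂ q) = 0) →
        (∀ q : ℝ, 0 < q → TLUq.IsTLPair (ψ₁ q) (ψ₂ q)) ∨
          {q : ℝ | 0 < q ∧ TLUq.IsTLPair (ψ₁ q) (ψ₂ q)}.Finite) := by
  constructor
  · intro J m hJ hm ψ hψ
    refine TLUq.forall_isTLSolution_or_finite (U := fun q => Submodule.span ℂ {ψ q}) ?_ fun q hq =>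
      TLUq.T12_mul_T23_projMatrix_ne_zero_of_eigenvector hJ hm hψ hq
        (Submodule.mem_span_singleton_self _)
    simp only [TLUq.projMatrix_span_singleton]
    exact TLUq.algEntries_lineProj_of_eigenvector hJ hm hψ
  · intro J₁ J₂ m₁ m₂ hJ₁ hm₁ hJ₂ hm₂ ψ₁ ψ₂ hψ₁ hψ₂ horth
    refine TLUq.forall_isTLSolution_or_finite (U := fun q => Submodule.span ℂ {ψ₁ q, ψ₂ q}) ?_
      fun q hq => TLUq.T12_mul_T23_projMatrix_ne_zero_of_eigenvector hJ₁ hm₁ hψ₁ hq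
        (Submodule.subset_span (Set.mem_insert _ _))
    simp only [fun s => TLUq.projMatrix_span_pair (horth (Real.exp (2 * s)) (Real.exp_pos _))]
    exact (TLUq.algEntries_lineProj_of_eigenvector hJ₁ hm₁ hψ₁).add
      (TLUq.algEntries_lineProj_of_eigenvector hJ₂ hm₂ hψ₂)
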